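/- Let $n\ge 2$ and let $K(x)=\dfrac{x_1x_2}{|x|^{n+2}}$, $x\in\mathbb R^n\setminus\{0\}$. For $f\in L^2(\mathbb R^n)$ and $\varepsilon>0$ put $$T^\varepsilon f(x)=\int_{|y|>\varepsilon} f(x-y)\,K(y)\,dy,\qquad Tf(x)=\lim_{\varepsilon\to0^+}T^\varepsilon f(x),\qquad T^*f(x)=\sup_{\varepsilon>0}|T^\varepsilon f(x)|,$$ and let $Mg(x)=\sup_{r>0}\frac1{|B(x,r)|}\int_{B(x,r)}|g(y)|\,dy$ be the Hardy–Littlewood maximal operator, where $B(x,r)$ is the closed ball with centre $x$ and radius $r$. For every $f\in L^2(\mathbb R^n)$ the integral defining $T^\varepsilon f(x)$ converges absolutely for all $x\in\mathbb R^n$ and $\varepsilon>0$, the limit $Tf(x)$ exists for almost every $x$, $Tf\in L^2(\mathbb R^n)$, and $$T^\varepsilon f(x)=\frac1{|B(x,\varepsilon)|}\int_{B(x,\varepsilon)}Tf(y)\,dy\qquad\text{for all }x\in\mathbb R^n,\ \varepsilon>0 .$$ There is a constant $C$, depending only on $n$, such that $$T^*f(x)\le C\,M(Tf)(x)\qquad\text{for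 all } x\in\mathbb R^n,\ f\in L^2(\mathbb R^n).$$ Moreover, there is a bounded measurable function $b:\mathbb R^n\to\mathbb R$ vanishing outside the closed unit ball $B=B(0,1)$ such that $T(b)(x)=\chi_{\mathbb R^n\setminus B}(x)\,K(x)$ for almost every $x\in\mathbb R^n$. -/

import Mathlib

open MeasureTheory Filter Topology
open scoped NNReal ENNReal

noncomputable section

/-- The kernel `x₁ x₂ / |x|^(n+2)` on `ℝⁿ`, `n ≥ 2` (its value at the origin plays no role). -/
def secondRieszKernel (n : ℕ) (hn : 2 ≤ n) (x : EuclideanSpace ℝ (Fin n)) : ℝ :=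
  x ⟨0, by omega⟩ * x ⟨1, by omega⟩ / ‖x‖ ^ (n + 2)

/-- The truncation at level `ε` of the convolution singular integral with kernel `K`:
`T^ε f(x) = ∫_{|y| > ε} f(x - y) K(y) dy`. -/
def truncatedSI {n : ℕ} (K : EuclideanSpace ℝ (Fin n) → ℝ) (ε : ℝ)
    (f : EuclideanSpace ℝ (Fin n) → ℂ) (x : EuclideanSpace ℝ (Fin n)) : ℂ :=
  ∫ y in {y | ε < ‖y‖}, f (x - y) * (K y : ℂ)

/-- The principal value singular integral `T f(x) = lim_{ε → 0+} T^ε f(x)`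
(an arbitrary value where the limit does not exist). -/
def principalValueSI {n : ℕ} (K : EuclideanSpace ℝ (Fin n) → ℝ)
    (f : EuclideanSpace ℝ (Fin n) → ℂ) (x : EuclideanSpace ℝ (Fin n)) : ℂ :=
  limUnder (𝓝[>] (0 : ℝ)) fun ε => truncatedSI K ε f x

/-- The maximal singular integral `T* f(x) = sup_{ε > 0} |T^ε f(x)|`, with values in `[0, ∞]`. -/
def maximalSI {n : ℕ} (K : EuclideanSpace ℝ (Fin n) → ℝ)
    (f : EuclideanSpace ℝ (Fin n) → ℂ) (x : EuclideanSpace ℝ (Fin n)) : ℝ≥0∞ :=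
  ⨆ (ε : ℝ) (_ : 0 < ε), ‖truncatedSI K ε f x‖ₑ

/-- The (centred) Hardy-Littlewood maximal operator
`M g(x) = sup_{r > 0} |B(x,r)|⁻¹ ∫_{B(x,r)} |g|`, with values in `[0, ∞]`. -/
def hardyLittlewoodMax {n : ℕ} (g : EuclideanSpace ℝ (Fin n) → ℂ)
    (x : EuclideanSpace ℝ (Fin n)) : ℝ≥0∞ :=
  ⨆ (r : ℝ) (_ : 0 < r),
    (volume (Metric.closedBall x r))⁻¹ * ∫⁻ y in Metric.closedBall x r, ‖g y‖ₑ

end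

/-! Let `ω` be the volume of the unit ball and let `φ` be the `C¹` function equal to a quadratic
polynomial on `B(a, ε)` and to a multiple of the fundamental solution of the Laplacian outside,
normalised so that `∇φ = (y - a) / max(ε, |y - a|)ⁿ`. This gradient is Lipschitz, so the weak second
derivatives of `φ` carry no surface term on the sphere. Hence `Δφ` is `nω` times the normalised
indicator of the ball, while `∂₁∂₂φ` is `-n` times the truncated kernel. The multiplier `ξ₁ξ₂/|ξ|²`
sends `Δφ` to `∂₁∂₂φ`, so the operator `R` with symbol `-ω ξ₁ξ₂/|ξ|²` sends the ball density to the
truncated kernel (`rieszOperator_ballDensity`).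

The symbol is real, so `R` is self-adjoint. Pairing `f` with the truncated kernel at `x` is then
pairing `R f` with the ball density: every truncation is a ball average of `R f`
(`truncatedSI_eq_average`). Lebesgue differentiation identifies `T f` with `R f` almost everywhere,
the maximal bound follows with `C = 1`, and `b` is the density of the unit ball. -/

/-! ### Weak derivatives of bounded Lipschitz functions. -/

section IntegrationByParts

open scoped SchwartzMap LineDeriv

variable {E : Type*} [NormedAddCommGroup E] [NormedSpace ℝ E] [FiniteDimensional ℝ E]
  [MeasurableSpace E] [BorelSpace E] {μ : Measure E} [μ.IsAddHaarMeasure]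

/-- The line derivatives of a Schwartz function are dominated, uniformly over translations by
vectors of bounded length, by an integrable function. -/
theorem SchwartzMap.exists_integrable_bound_fderiv_add (g : 𝓢(E, ℂ)) (v : E) :
    ∃ B : E → ℝ, Integrable B μ ∧
      ∀ x w : E, ‖w‖ ≤ ‖v‖ → ‖fderiv ℝ g (x + w) v‖ ≤ B x := by
  -- An exponent above the dimension makes `(1 + ‖x‖) ^ (-N)` integrable.
  set N : ℕ := Module.finrank ℝ E + 1 with hN
  set S : ℝ := 2 ^ N * (Finset.Iic (N, 0)).sup
    (fun m => SchwartzMap.seminorm ℝ (E := E) (F := ℂ) m.1 m.2) (∂_{v} g) with hS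
  refine ⟨fun x => S * (1 + ‖v‖) ^ N * (1 + ‖x‖) ^ (-(N : ℝ)),
    (integrable_one_add_norm (by rw [hN]; push_cast; linarith)).const_mul _, fun x w hw => ?_⟩
  have h1 : (1 + ‖x + w‖) ^ N * ‖fderiv ℝ g (x + w) v‖ ≤ S := by
    simpa [SchwartzMap.lineDerivOp_apply_eq_fderiv] using
      SchwartzMap.one_add_le_sup_seminorm_apply (𝕜 := ℝ) (m := (N, 0)) (k := N) (n := 0)
      le_rfl le_rfl (∂_{v} g) (x + w)
  have h2 : (1 + ‖x‖) ≤ (1 + ‖v‖) * (1 + ‖x + w‖) := by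
    have : ‖x‖ ≤ ‖x + w‖ + ‖w‖ := by simpa using norm_sub_le (x + w) w
    nlinarith [norm_nonneg v, norm_nonneg (x + w), mul_nonneg (norm_nonneg v) (norm_nonneg (x + w))]
  have h3 : (1 + ‖x‖) ^ N ≤ (1 + ‖v‖) ^ N * (1 + ‖x + w‖) ^ N := by
    rw [← mul_pow]; gcongr
  have h0 : 0 < (1 + ‖x‖) ^ N := by positivity
  beta_reduce
  rw [Real.rpow_neg (by positivity), Real.rpow_natCast, ← div_eq_mul_inv, le_div_iff₀ h0]
  calc ‖fderiv ℝ g (x + w) v‖ * (1 + ‖x‖) ^ N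
      ≤ ‖fderiv ℝ g (x + w) v‖ * ((1 + ‖v‖) ^ N * (1 + ‖x + w‖) ^ N) := by gcongr
    _ = ((1 + ‖x + w‖) ^ N * ‖fderiv ℝ g (x + w) v‖) * (1 + ‖v‖) ^ N := by ring
    _ ≤ S * (1 + ‖v‖) ^ N := by gcongr

/-- Integration by parts of a bounded Lipschitz function against a Schwartz function. -/
theorem LipschitzWith.integral_mul_schwartzMap_eq_neg {G G' : E → ℝ} {C : ℝ≥0} {M : ℝ}
    (hG : LipschitzWith C G) (hM : ∀ x, |G x| ≤ M) (v : E)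
    (hG' : ∀ᵐ x ∂μ, HasLineDerivAt ℝ G (G' x) x v) (hm : AEStronglyMeasurable G' μ)
    (g : 𝓢(E, ℂ)) :
    ∫ x, (G' x : ℂ) * g x ∂μ = - ∫ x, (G x : ℂ) * fderiv ℝ g x v ∂μ := by
  have hGc : Continuous G := hG.continuous
  have hgint : Integrable g μ := g.integrable
  have hint : ∀ t : ℝ, Integrable (fun x => (G (x + t • v) : ℂ) * g x) μ := fun t => by
    refine hgint.bdd_mul (c := M) (by fun_prop) (Eventually.of_forall fun x => ?_)
    simpa using hM (x + t • v)
  -- The same integral is differentiated at `t = 0` with the translation placed on `G` and then on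
  -- `g`. On `G` only almost everywhere differentiability is known, and the Lipschitz bound supplies
  -- the domination.
  have hA := hasDerivAt_integral_of_dominated_loc_of_lip (𝕜 := ℝ) (μ := μ) (x₀ := (0 : ℝ))
    (s := Set.univ) (F := fun t x => (G (x + t • v) : ℂ) * g x)
    (F' := fun x => (G' x : ℂ) * g x) (bound := fun x => C * ‖v‖ * ‖g x‖)
    univ_mem (Eventually.of_forall fun t => (hint t).aestronglyMeasurable) (hint 0)
    ((Complex.continuous_ofReal.comp_aestronglyMeasurable hm).mul hgint.aestronglyMeasurable)
    (Eventually.of_forall fun x => by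
      refine LipschitzWith.lipschitzOnWith (LipschitzWith.of_dist_le_mul fun s t => ?_)
      have h1 := hG.dist_le_mul (x + s • v) (x + t • v)
      rw [dist_add_left, dist_eq_norm, dist_eq_norm, ← sub_smul, norm_smul] at h1
      rw [dist_eq_norm, dist_eq_norm, ← sub_mul, norm_mul, ← Complex.ofReal_sub,
        Complex.norm_real, Real.coe_nnabs, abs_of_nonneg (by positivity)]
      calc _ ≤ (C * (‖s - t‖ * ‖v‖)) * ‖g x‖ := by gcongr
        _ = _ := by ring)
    (hgint.norm.const_mul _)
    (hG'.mono fun x hx => by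
      have : HasDerivAt (fun t : ℝ => G (x + t • v)) (G' x) 0 := hx
      exact (this.ofReal_comp).mul_const (g x))
  obtain ⟨B, hB, hBb⟩ := g.exists_integrable_bound_fderiv_add (μ := μ) v
  have hgc : Continuous g := g.continuous
  have hint' : ∀ t : ℝ, Integrable (fun x => (G x : ℂ) * g (x - t • v)) μ := fun t => by
    refine (hgint.comp_sub_right (t • v)).bdd_mul (c := M) (by fun_prop)
      (Eventually.of_forall fun x => ?_)
    simpa using hM x
  have hderiv : ∀ x (t : ℝ), HasDerivAt (fun t : ℝ => g (x - t • v))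
      (-fderiv ℝ g (x - t • v) v) t := fun x t => by
    have h1 : HasDerivAt (fun t : ℝ => x - t • v) (-v) t := by
      simpa using ((hasDerivAt_id t).smul_const v).const_sub x
    rw [← map_neg]
    exact (g.differentiableAt (x := x - t • v)).hasFDerivAt.comp_hasDerivAt t h1
  have hfd : Continuous (fun x => fderiv ℝ g x v) := (∂_{v} g).continuous
  have hBn := hasDerivAt_integral_of_dominated_loc_of_deriv_le (𝕜 := ℝ) (μ := μ) (x₀ := (0 : ℝ))
    (s := Metric.ball 0 1) (F := fun t x => (G x : ℂ) * g (x - t • v))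
    (F' := fun t x => (G x : ℂ) * (-fderiv ℝ g (x - t • v) v)) (bound := fun x => M * B x)
    (Metric.ball_mem_nhds _ one_pos)
    (Eventually.of_forall fun t => (hint' t).aestronglyMeasurable) (hint' 0)
    (by
      have : Continuous fun x => (G x : ℂ) * (-fderiv ℝ g (x - (0 : ℝ) • v) v) := by fun_prop
      exact this.aestronglyMeasurable)
    (Eventually.of_forall fun x t ht => by
      rw [norm_mul, norm_neg, Complex.norm_real]
      refine mul_le_mul (hM x) ?_ (norm_nonneg _) ((abs_nonneg _).trans (hM x))
      rw [sub_eq_add_neg]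
      refine hBb x _ ?_
      rw [norm_neg, norm_smul]
      have : ‖t‖ ≤ 1 := by simpa using (mem_ball_zero_iff.mp ht).le
      nlinarith [norm_nonneg v])
    (hB.const_mul M)
    (Eventually.of_forall fun x t _ => (hderiv x t).const_mul _)
  have heq : (fun t : ℝ => ∫ x, (G (x + t • v) : ℂ) * g x ∂μ)
      = fun t : ℝ => ∫ x, (G x : ℂ) * g (x - t • v) ∂μ := by
    funext t
    rw [← integral_sub_right_eq_self (fun x => (G (x + t • v) : ℂ) * g x) (t • v)]
    simp
  have h2 := hA.2
  rw [heq] at h2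
  rw [h2.unique hBn.2]
  simp [integral_neg]

end IntegrationByParts

/-! ### From equal weak derivatives to relations between Fourier transforms. -/

section FourierSide

open scoped SchwartzMap LineDeriv FourierTransform

variable {E : Type*} [NormedAddCommGroup E] [InnerProductSpace ℝ E] [FiniteDimensional ℝ E]
  [MeasurableSpace E] [BorelSpace E]

omit [FiniteDimensional ℝ E] [MeasurableSpace E] [BorelSpace E] in
theorem SchwartzMap.fderiv_lineDerivOp_comm (g : 𝓢(E, ℂ)) (v w x : E) :
    fderiv ℝ (∂_{v} g : 𝓢(E, ℂ)) x w = fderiv ℝ (∂_{w} g : 𝓢(E, ℂ)) x v := by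
  have hd : DifferentiableAt ℝ (fderiv ℝ g) x :=
    ((g.smooth 2).fderiv_right (m := 1) (by norm_num)).differentiable (by norm_num) x
  have h : ∀ a b : E, fderiv ℝ (∂_{a} g : 𝓢(E, ℂ)) x b = fderiv ℝ (fderiv ℝ g) x b a := fun a b => by
    have : (⇑(∂_{a} g : 𝓢(E, ℂ)) : E → ℂ) = fun y => fderiv ℝ g y a := rfl
    rw [this, fderiv_clm_apply hd (by fun_prop)]
    simp
  rw [h, h]
  exact ((g.smooth 2).contDiffAt.isSymmSndFDerivAt (by simp)).eq w v

/-- If the distributional derivatives `∂_w u` and `∂_v u'` of `L²` functions agree, then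
`⟪ξ, w⟫ û = ⟪ξ, v⟫ û'`. -/
theorem ae_inner_mul_fourier_eq {u u' : Lp (α := E) ℂ 2} {v w : E}
    (h : ∀ g : 𝓢(E, ℂ), ∫ x, u x * fderiv ℝ g x w = ∫ x, u' x * fderiv ℝ g x v) :
    ∀ᵐ ξ : E, ((inner ℝ ξ w : ℝ) : ℂ) * (𝓕 u : Lp (α := E) ℂ 2) ξ =
      ((inner ℝ ξ v : ℝ) : ℂ) * (𝓕 u' : Lp (α := E) ℂ 2) ξ := by
  have hd : ∂_{w} (u : 𝓢'(E, ℂ)) = ∂_{v} (u' : 𝓢'(E, ℂ)) := by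
    ext g
    have := h g
    simp only [TemperedDistribution.lineDerivOp_apply_apply, map_neg,
      Lp.toTemperedDistribution_apply, SchwartzMap.lineDerivOp_apply_eq_fderiv, smul_eq_mul]
    simpa [mul_comm] using this
  have hF := congrArg (fun T : 𝓢'(E, ℂ) => 𝓕 T) hd
  simp only [TemperedDistribution.fourier_lineDerivOp_eq,
    Lp.fourier_toTemperedDistribution_eq] at hF
  have hpi : (2 * Real.pi * Complex.I : ℂ) ≠ 0 := by simp [Real.pi_ne_zero]
  have hloc : ∀ (f : Lp (α := E) ℂ 2) (v : E),
      LocallyIntegrable (fun ξ => ((inner ℝ ξ v : ℝ) : ℂ) * f ξ) := fun f v => by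
    have h1 : LocallyIntegrable f := (Lp.memLp f).locallyIntegrable (by norm_num)
    have h2 : Continuous fun ξ : E => ((inner ℝ ξ v : ℝ) : ℂ) := by fun_prop
    rw [← locallyIntegrableOn_univ] at h1 ⊢
    exact h1.continuousOn_mul h2.continuousOn isOpen_univ.isLocallyClosed
  -- The products with a linear factor need not be in `L²`, but they are locally integrable, so
  -- smooth compactly supported tests determine them.
  refine ae_eq_of_integral_contDiff_smul_eq (hloc _ _) (hloc _ _) fun g hg hgc => ?_
  have hg₁ : HasCompactSupport (Complex.ofRealCLM ∘ g) := hgc.comp_left rfl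
  have hg₂ : ContDiff ℝ (↑(⊤ : ℕ∞)) (Complex.ofRealCLM ∘ g) := by fun_prop
  have h3 := congrArg (fun T : 𝓢'(E, ℂ) => T (hg₁.toSchwartzMap hg₂)) hF
  have ht : ∀ v : E, (fun ξ : E => ((inner ℝ ξ v : ℝ) : ℂ)).HasTemperateGrowth := fun v => by
    fun_prop
  have h4 : ∀ T : 𝓢'(E, ℂ), ∀ f : 𝓢(E, ℂ), ((2 * Real.pi * Complex.I : ℂ) • T) f =
    (2 * Real.pi * Complex.I : ℂ) * T f := fun _ _ => rfl
  simp only [h4] at h3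
  replace h3 := mul_left_cancel₀ hpi h3
  simp only [TemperedDistribution.smulLeftCLM_apply_apply, Lp.toTemperedDistribution_apply] at h3
  simp only [SchwartzMap.smulLeftCLM_apply_apply (ht _)] at h3
  have h5 : ∀ (f : Lp (α := E) ℂ 2) (v : E), ∫ ξ, g ξ • (((inner ℝ ξ v : ℝ) : ℂ) * f ξ) =
      ∫ ξ, (((inner ℝ ξ v : ℝ) : ℂ) • (hg₁.toSchwartzMap hg₂) ξ) • f ξ := fun f v => by
    refine integral_congr_ae (Eventually.of_forall fun ξ => ?_)
    simp only [HasCompactSupport.toSchwartzMap_toFun, Function.comp_apply, Complex.ofRealCLM_apply,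
      smul_eq_mul, Complex.real_smul]
    ring
  rw [h5, h5]
  exact h3

end FourierSide

/-! ### The gradient field and its derivatives. -/

section RadialField

variable {n : ℕ}

/-- The vector field `(y - a) / max(ε, |y - a|)ⁿ`: up to a constant factor, the gradient of the
`C¹` function which is a quadratic polynomial on `B(a, ε)` and the fundamental solution of the
Laplacian, centred at `a`, outside. -/
noncomputable def radialField (a : EuclideanSpace ℝ (Fin n)) (ε : ℝ) (i : Fin n)
    (y : EuclideanSpace ℝ (Fin n)) : ℝ :=
  (y - a) i / max ε ‖y - a‖ ^ n

/-- The derivative in the direction of the `j`-th axis of the `i`-th component of `radialField`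
(off the sphere `|y - a| = ε`). -/
noncomputable def radialFieldDeriv (a : EuclideanSpace ℝ (Fin n)) (ε : ℝ) (i j : Fin n)
    (y : EuclideanSpace ℝ (Fin n)) : ℝ :=
  if ‖y - a‖ ≤ ε then (if i = j then 1 else 0) / ε ^ n
  else (if i = j then 1 else 0) / ‖y - a‖ ^ n - n * ((y - a) i * (y - a) j) / ‖y - a‖ ^ (n + 2)

theorem abs_coord_le_norm (z : EuclideanSpace ℝ (Fin n)) (i : Fin n) : |z i| ≤ ‖z‖ :=
  PiLp.norm_apply_le z i

theorem abs_radialField_le (hn : 1 ≤ n) (a : EuclideanSpace ℝ (Fin n)) {ε : ℝ} (hε : 0 < ε)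
    (i : Fin n) (y : EuclideanSpace ℝ (Fin n)) : |radialField a ε i y| ≤ 1 / ε ^ (n - 1) := by
  obtain ⟨m, rfl⟩ : ∃ m, n = m + 1 := ⟨n - 1, by omega⟩
  have hM : 0 < max ε ‖y - a‖ := lt_max_of_lt_left hε
  have hle : ε ≤ max ε ‖y - a‖ := le_max_left _ _
  rw [radialField, abs_div, abs_of_pos (pow_pos hM _), div_le_div_iff₀ (by positivity)
    (by positivity), Nat.add_sub_cancel, pow_succ, one_mul, mul_comm]
  gcongr
  exact (abs_coord_le_norm _ i).trans (le_max_right _ _)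

/-- The inner and outer formulas match on the sphere, so the derivative off the sphere is the whole
weak derivative. In the constant, `1` comes from varying the numerator and `n` from varying the
denominator. -/
theorem lipschitzWith_radialField (a : EuclideanSpace ℝ (Fin n)) {ε : ℝ} (hε : 0 < ε)
    (i : Fin n) : LipschitzWith (Real.toNNReal ((n + 1) / ε ^ n)) (radialField a ε i) := by
  refine LipschitzWith.of_dist_le_mul fun x y => ?_
  rw [Real.coe_toNNReal _ (by positivity), Real.dist_eq, dist_eq_norm]
  obtain ⟨m, rfl⟩ : ∃ m, n = m + 1 := ⟨n - 1, by have := i.pos; omega⟩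
  wlog h : ‖y - a‖ ≤ ‖x - a‖ generalizing x y
  · have := this y x (le_of_not_ge h)
    rwa [abs_sub_comm, norm_sub_rev] at this
  set r := max ε ‖x - a‖ with hr
  set s := max ε ‖y - a‖ with hs
  have hs0 : 0 < s := lt_max_of_lt_left hε
  have hsε : ε ≤ s := le_max_left _ _
  have hsr : s ≤ r := max_le_max le_rfl h
  have hr0 : 0 < r := hs0.trans_le hsr
  have hd : r - s ≤ ‖x - y‖ := by
    have h1 := abs_max_sub_max_le_abs ‖x - a‖ ‖y - a‖ ε
    rw [max_comm _ ε, max_comm _ ε] at h1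
    have h2 := abs_norm_sub_norm_le (x - a) (y - a)
    rw [sub_sub_sub_cancel_right] at h2
    exact (le_abs_self _).trans (h1.trans h2)
  have hpow : r ^ (m + 1) - s ^ (m + 1) ≤ (r - s) * (m + 1 : ℕ) * r ^ m := by
    have h1 := abs_pow_sub_pow_le (a := r) (b := s) (n := m + 1)
    rw [abs_of_pos hr0, abs_of_pos hs0, max_eq_left hsr, abs_of_nonneg (sub_nonneg.2 hsr)] at h1
    exact (le_abs_self _).trans h1
  have hpow0 : s ^ (m + 1) ≤ r ^ (m + 1) := by gcongr
  have hy : |(y - a) i| ≤ s := (abs_coord_le_norm _ i).trans (le_max_right _ _)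
  have hxy : |(x - y) i| ≤ ‖x - y‖ := abs_coord_le_norm _ i
  have hsplit : radialField a ε i x - radialField a ε i y =
      (x - y) i / r ^ (m + 1) -
        (y - a) i * (r ^ (m + 1) - s ^ (m + 1)) / (r ^ (m + 1) * s ^ (m + 1)) := by
    simp only [radialField, ← hr, ← hs, PiLp.sub_apply]
    field_simp
    ring
  have h1 : |(x - y) i / r ^ (m + 1)| ≤ ‖x - y‖ / ε ^ (m + 1) := by
    rw [abs_div, abs_of_pos (pow_pos hr0 _)]
    gcongr
    exact hsε.trans hsr
  have h2 : |(y - a) i * (r ^ (m + 1) - s ^ (m + 1)) / (r ^ (m + 1) * s ^ (m + 1))| ≤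
      (m + 1 : ℕ) * ‖x - y‖ / ε ^ (m + 1) := by
    rw [abs_div, abs_mul, abs_of_nonneg (sub_nonneg.2 hpow0),
      abs_of_pos (a := r ^ (m + 1) * s ^ (m + 1)) (by positivity)]
    calc _ ≤ s * (‖x - y‖ * (m + 1 : ℕ) * r ^ m) / (r ^ (m + 1) * s ^ (m + 1)) := by
          gcongr
          exact hpow.trans (by gcongr)
      _ = (m + 1 : ℕ) * ‖x - y‖ / (r * s ^ m) := by
          rw [div_eq_div_iff (by positivity) (by positivity)]; ring
      _ ≤ (m + 1 : ℕ) * ‖x - y‖ / ε ^ (m + 1) := by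
          rw [pow_succ, mul_comm (ε ^ m)]
          gcongr
          exact hsε.trans hsr
  rw [hsplit]
  calc _ ≤ ‖x - y‖ / ε ^ (m + 1) + (m + 1 : ℕ) * ‖x - y‖ / ε ^ (m + 1) :=
        (abs_sub _ _).trans (add_le_add h1 h2)
    _ = _ := by ring

theorem hasLineDerivAt_radialField (a : EuclideanSpace ℝ (Fin n)) {ε : ℝ} (hε : 0 < ε)
    (i j : Fin n) {y : EuclideanSpace ℝ (Fin n)} (hy : ‖y - a‖ ≠ ε) :
    HasLineDerivAt ℝ (radialField a ε i) (radialFieldDeriv a ε i j y) y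
      (EuclideanSpace.single j 1) := by
  set e : EuclideanSpace ℝ (Fin n) := EuclideanSpace.single j 1 with he
  have hc : HasDerivAt (fun t : ℝ => y + t • e - a) e 0 := by
    simpa using (((hasDerivAt_id (0 : ℝ)).smul_const e).const_add y).sub_const a
  have hnum : HasDerivAt (fun t : ℝ => (y + t • e - a) i) (if i = j then 1 else 0) 0 := by
    have := ((EuclideanSpace.proj (𝕜 := ℝ) i).hasFDerivAt (x := y + (0 : ℝ) • e - a)).comp_hasDerivAt
      (0 : ℝ) hc
    simpa [he, Function.comp_def, Pi.single_apply] using this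
  have hcont : ContinuousAt (fun t : ℝ => ‖y + t • e - a‖) 0 := by fun_prop
  have h00 : y + (0 : ℝ) • e - a = y - a := by simp
  have hz0 : ‖y + (0 : ℝ) • e - a‖ = ‖y - a‖ := by rw [h00]
  rcases lt_or_gt_of_ne hy with h | h
  · have hev : (fun t : ℝ => radialField a ε i (y + t • e)) =ᶠ[𝓝 0]
        fun t => (y + t • e - a) i / ε ^ n := by
      filter_upwards [hcont.eventually_lt continuousAt_const (by rwa [hz0])] with t ht
      rw [radialField, max_eq_left (le_of_lt ht)]
    have : radialFieldDeriv a ε i j y = (if i = j then 1 else 0) / ε ^ n := by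
      rw [radialFieldDeriv, if_pos h.le]
    rw [HasLineDerivAt, this]
    exact (hnum.div_const _).congr_of_eventuallyEq hev
  · have hev : (fun t : ℝ => radialField a ε i (y + t • e)) =ᶠ[𝓝 0]
        fun t => (y + t • e - a) i / ‖y + t • e - a‖ ^ n := by
      filter_upwards [continuousAt_const.eventually_lt hcont (by rwa [hz0])] with t ht
      rw [radialField, max_eq_right (le_of_lt ht)]
    have hpos : 0 < ‖y - a‖ := hε.trans h
    have hinner : inner ℝ (y - a) e = (y - a) j := by
      simp [he, EuclideanSpace.inner_single_right]
    have hnorm : HasDerivAt (fun t : ℝ => ‖y + t • e - a‖) ((y - a) j / ‖y - a‖) 0 := by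
      have h1 := hc.norm_sq
      rw [h00, hinner] at h1
      have h2 := h1.sqrt (by rw [hz0]; positivity)
      simp only [Real.sqrt_sq (norm_nonneg _)] at h2
      rw [hz0] at h2
      convert h2 using 1
      field_simp
    have hq := hnum.div (hnorm.pow n) (by simp only [Pi.pow_apply]; rw [hz0]; positivity)
    rw [HasLineDerivAt, radialFieldDeriv, if_neg (not_le.2 h)]
    refine HasDerivAt.congr_of_eventuallyEq ?_ hev
    simp only [Pi.pow_apply, h00] at hq
    refine HasDerivAt.congr_deriv hq ?_
    obtain ⟨m, rfl⟩ : ∃ m, n = m + 1 := ⟨n - 1, by have := i.pos; omega⟩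
    simp only [Nat.add_sub_cancel]
    field_simp
    ring

theorem ae_norm_sub_ne (hn : 1 ≤ n) (a : EuclideanSpace ℝ (Fin n)) (ε : ℝ) :
    ∀ᵐ y : EuclideanSpace ℝ (Fin n), ‖y - a‖ ≠ ε := by
  have : Nonempty (Fin n) := ⟨⟨0, hn⟩⟩
  have h := Measure.addHaar_sphere (volume : Measure (EuclideanSpace ℝ (Fin n))) a ε
  have h2 : {y | ¬ ‖y - a‖ ≠ ε} = Metric.sphere a ε := by
    ext y; simp
  rw [ae_iff, h2, h]

theorem measurable_radialFieldDeriv (a : EuclideanSpace ℝ (Fin n)) (ε : ℝ) (i j : Fin n) :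
    Measurable (radialFieldDeriv a ε i j) := by
  unfold radialFieldDeriv
  refine Measurable.ite (measurableSet_le (by fun_prop) measurable_const) measurable_const ?_
  fun_prop

theorem abs_radialFieldDeriv_le (a : EuclideanSpace ℝ (Fin n)) {ε : ℝ} (hε : 0 < ε)
    (i j : Fin n) (y : EuclideanSpace ℝ (Fin n)) :
    |radialFieldDeriv a ε i j y| ≤ (n + 1) / max ε ‖y - a‖ ^ n := by
  have hδ : |(if i = j then (1 : ℝ) else 0)| ≤ 1 := by split_ifs <;> simp
  unfold radialFieldDeriv
  split_ifs with h hij hij <;> simp only [hij, if_true, if_false] at hδ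
  · rw [max_eq_left h, abs_of_pos (by positivity)]
    gcongr
    linarith [n.cast_nonneg (α := ℝ)]
  · simp only [zero_div, abs_zero]
    positivity
  all_goals
    rw [not_le] at h
    have hz : 0 < ‖y - a‖ := hε.trans h
    rw [max_eq_right h.le]
    refine (abs_sub _ _).trans ?_
    rw [abs_div, abs_div, abs_of_pos (pow_pos hz n), abs_of_pos (pow_pos hz (n + 2)), abs_mul,
      Nat.abs_cast, abs_mul]
    have h1 : n * (|(y - a) i| * |(y - a) j|) / ‖y - a‖ ^ (n + 2) ≤ n / ‖y - a‖ ^ n := by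
      rw [div_le_div_iff₀ (by positivity) (by positivity), pow_add, mul_assoc]
      refine mul_le_mul_of_nonneg_left ?_ (by positivity)
      rw [mul_comm, sq]
      gcongr <;> exact abs_coord_le_norm _ _
    calc _ ≤ 1 / ‖y - a‖ ^ n + n / ‖y - a‖ ^ n := by gcongr
      _ = _ := by ring

theorem memLp_radialFieldDeriv (hn : 1 ≤ n) (a : EuclideanSpace ℝ (Fin n)) {ε : ℝ} (hε : 0 < ε)
    (i j : Fin n) : MemLp (fun y => (radialFieldDeriv a ε i j y : ℂ)) 2 volume := by
  have hm := measurable_radialFieldDeriv a ε i j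
  rw [memLp_two_iff_integrable_sq_norm (by fun_prop)]
  set c : ℝ := (n + 1) * ((1 + ε) / ε) ^ n with hcdef
  have hint : Integrable (fun y : EuclideanSpace ℝ (Fin n) =>
      c ^ 2 * (1 + ‖y - a‖) ^ (-(2 * n : ℝ))) := by
    refine Integrable.const_mul ?_ _
    refine Integrable.comp_sub_right (f := fun y : EuclideanSpace ℝ (Fin n) =>
      (1 + ‖y‖) ^ (-(2 * n : ℝ))) (integrable_one_add_norm ?_) a
    have : (0 : ℝ) < n := by exact_mod_cast hn
    rw [finrank_euclideanSpace_fin]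
    linarith
  refine hint.mono' (by fun_prop) (Eventually.of_forall fun y => ?_)
  have hz := norm_nonneg (y - a)
  have hM : 0 < max ε ‖y - a‖ := lt_max_of_lt_left hε
  -- This trades `max ε ‖y - a‖` for `1 + ‖y - a‖`. After squaring, the decay exponent `2n` exceeds
  -- the dimension.
  have h1 : 1 + ‖y - a‖ ≤ (1 + ε) / ε * max ε ‖y - a‖ := by
    have h2 : ε ≤ max ε ‖y - a‖ := le_max_left _ _
    have h3 : ‖y - a‖ ≤ max ε ‖y - a‖ := le_max_right _ _
    rw [div_mul_eq_mul_div, le_div_iff₀ hε]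
    nlinarith
  have h2 : |radialFieldDeriv a ε i j y| ≤ c / (1 + ‖y - a‖) ^ n := by
    refine (abs_radialFieldDeriv_le a hε i j y).trans ?_
    rw [div_le_div_iff₀ (by positivity) (by positivity), hcdef, mul_assoc, ← mul_pow]
    gcongr
  rw [Complex.norm_real, Real.norm_of_nonneg (by positivity), Real.rpow_neg (by positivity)]
  have h4 : (1 + ‖y - a‖) ^ (2 * n : ℝ) = ((1 + ‖y - a‖) ^ n) ^ 2 := by
    rw [← pow_mul, ← Real.rpow_natCast]
    congr 1
    push_cast
    ring
  rw [h4, ← div_eq_mul_inv, ← div_pow, Real.norm_eq_abs]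
  gcongr

theorem radialFieldDeriv_comm (a : EuclideanSpace ℝ (Fin n)) (ε : ℝ) (i j : Fin n) :
    radialFieldDeriv a ε i j = radialFieldDeriv a ε j i := by
  funext y
  simp only [radialFieldDeriv, eq_comm (a := i), mul_comm ((y - a) i)]

theorem sum_radialFieldDeriv (a : EuclideanSpace ℝ (Fin n)) {ε : ℝ} (hε : 0 < ε)
    (y : EuclideanSpace ℝ (Fin n)) :
    ∑ i, radialFieldDeriv a ε i i y =
      (Metric.closedBall a ε).indicator (fun _ => (n : ℝ) / ε ^ n) y := by
  by_cases h : ‖y - a‖ ≤ ε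
  · rw [Set.indicator_of_mem (by rwa [mem_closedBall_iff_norm])]
    simp [radialFieldDeriv, h, div_eq_mul_inv]
  · rw [Set.indicator_of_notMem (by rwa [mem_closedBall_iff_norm])]
    have hz : 0 < ‖y - a‖ := hε.trans (not_le.1 h)
    -- Outside the ball the trace cancels, `n/|z|ⁿ - n|z|²/|z|ⁿ⁺² = 0`: the fundamental solution is
    -- harmonic.
    simp only [radialFieldDeriv, h, if_false, if_true, Finset.sum_sub_distrib]
    rw [← Finset.sum_div, ← Finset.sum_div, ← Finset.mul_sum]
    have : ∑ i, (y - a) i * (y - a) i = ‖y - a‖ ^ 2 := by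
      rw [EuclideanSpace.real_norm_sq_eq]
      simp [sq]
    rw [this]
    simp
    field_simp
    ring

theorem radialFieldDeriv_zero_one (hn : 2 ≤ n) (a : EuclideanSpace ℝ (Fin n)) (ε : ℝ)
    (y : EuclideanSpace ℝ (Fin n)) :
    radialFieldDeriv a ε ⟨0, by omega⟩ ⟨1, by omega⟩ y =
      -n * {y | ε < ‖y - a‖}.indicator (fun y => secondRieszKernel n hn (y - a)) y := by
  by_cases h : ‖y - a‖ ≤ ε
  · rw [Set.indicator_of_notMem (by simpa using h)]
    simp [radialFieldDeriv, h]
  · rw [Set.indicator_of_mem (by simpa using h)]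
    simp [radialFieldDeriv, h, secondRieszKernel]
    ring

open scoped SchwartzMap in
/-- The distributional derivative `∂_k ∂_j` of the radial field is symmetric in `j` and `k`. -/
theorem integral_radialFieldDeriv_mul_fderiv (hn : 1 ≤ n) (a : EuclideanSpace ℝ (Fin n)) {ε : ℝ}
    (hε : 0 < ε) (i j k : Fin n) (g : 𝓢(EuclideanSpace ℝ (Fin n), ℂ)) :
    ∫ y, (radialFieldDeriv a ε i j y : ℂ) * fderiv ℝ g y (EuclideanSpace.single k 1) =
      ∫ y, (radialFieldDeriv a ε i k y : ℂ) * fderiv ℝ g y (EuclideanSpace.single j 1) := by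
  -- Moving `∂_j` onto the test function leaves its second derivatives, which commute.
  have h : ∀ j k : Fin n,
      ∫ y, (radialFieldDeriv a ε i j y : ℂ) * fderiv ℝ g y (EuclideanSpace.single k 1) =
        -∫ y, (radialField a ε i y : ℂ) *
          fderiv ℝ (LineDeriv.lineDerivOp (EuclideanSpace.single k (1 : ℝ)) g :
            𝓢(EuclideanSpace ℝ (Fin n), ℂ)) y (EuclideanSpace.single j 1) := fun j k =>
    (lipschitzWith_radialField a hε i).integral_mul_schwartzMap_eq_neg
      (abs_radialField_le hn a hε i) _
      ((ae_norm_sub_ne hn a ε).mono fun y hy => hasLineDerivAt_radialField a hε i j hy)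
      (measurable_radialFieldDeriv a ε i j).aestronglyMeasurable
      (LineDeriv.lineDerivOp (EuclideanSpace.single k (1 : ℝ)) g :
        𝓢(EuclideanSpace ℝ (Fin n), ℂ))
  rw [h, h]
  simp only [g.fderiv_lineDerivOp_comm (EuclideanSpace.single k 1) (EuclideanSpace.single j 1)]

end RadialField

/-! ### The multiplier operator and ball averages. -/

section RieszOperator

open scoped FourierTransform

variable {n : ℕ}

/-- The Fourier symbol of the principal value convolution with `secondRieszKernel`. -/
noncomputable def rieszSymbol (n : ℕ) (hn : 2 ≤ n) (ξ : EuclideanSpace ℝ (Fin n)) : ℝ :=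
  -volume.real (Metric.closedBall (0 : EuclideanSpace ℝ (Fin n)) 1) *
    (ξ ⟨0, by omega⟩ * ξ ⟨1, by omega⟩ / ‖ξ‖ ^ 2)

theorem memLp_rieszSymbol_mul (hn : 2 ≤ n) (f : Lp (α := EuclideanSpace ℝ (Fin n)) ℂ 2 volume) :
    MemLp (fun ξ => (rieszSymbol n hn ξ : ℂ) * f ξ) 2 volume := by
  have hm : Measurable (rieszSymbol n hn) := by unfold rieszSymbol; fun_prop
  refine (Lp.memLp f).of_le_mul
    (c := volume.real (Metric.closedBall (0 : EuclideanSpace ℝ (Fin n)) 1))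
    (AEStronglyMeasurable.mul (by fun_prop) (Lp.aestronglyMeasurable f))
    (Eventually.of_forall fun ξ => ?_)
  rw [norm_mul, Complex.norm_real, Real.norm_eq_abs, rieszSymbol, abs_mul, abs_neg,
    abs_of_nonneg measureReal_nonneg, abs_div, abs_mul, abs_of_nonneg (sq_nonneg ‖ξ‖)]
  gcongr
  refine mul_le_of_le_one_right measureReal_nonneg (div_le_one_of_le₀ ?_ (sq_nonneg _))
  rw [sq]
  gcongr <;> exact abs_coord_le_norm _ _

/-- The Fourier multiplier operator on `L²` with symbol `rieszSymbol`. -/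
noncomputable def rieszOperator (hn : 2 ≤ n) (f : Lp (α := EuclideanSpace ℝ (Fin n)) ℂ 2 volume) :
    Lp (α := EuclideanSpace ℝ (Fin n)) ℂ 2 volume :=
  𝓕⁻ ((memLp_rieszSymbol_mul hn (𝓕 f)).toLp _)

theorem fourier_rieszOperator_ae (hn : 2 ≤ n) (f : Lp (α := EuclideanSpace ℝ (Fin n)) ℂ 2 volume) :
    (𝓕 (rieszOperator hn f) : Lp (α := EuclideanSpace ℝ (Fin n)) ℂ 2 volume) =ᵐ[volume]
      fun ξ => (rieszSymbol n hn ξ : ℂ) * (𝓕 f : Lp (α := EuclideanSpace ℝ (Fin n)) ℂ 2 volume) ξ := by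
  rw [rieszOperator, FourierTransform.fourier_fourierInv_eq]
  exact MemLp.coeFn_toLp _

/-- By Plancherel, self-adjointness reduces to the symbol being real. -/
theorem inner_rieszOperator_comm (hn : 2 ≤ n)
    (f g : Lp (α := EuclideanSpace ℝ (Fin n)) ℂ 2 volume) :
    inner ℂ (rieszOperator hn g) f = inner ℂ g (rieszOperator hn f) := by
  rw [← Lp.inner_fourier_eq, ← Lp.inner_fourier_eq g, L2.inner_def, L2.inner_def]
  refine integral_congr_ae ?_
  filter_upwards [fourier_rieszOperator_ae hn f, fourier_rieszOperator_ae hn g] with ξ hf hg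
  rw [hf, hg]
  simp only [RCLike.inner_apply, map_mul, Complex.conj_ofReal]
  ring

/-- The kernel `secondRieszKernel`, truncated at level `ε` and centred at `a`. -/
noncomputable def truncatedKernel (hn : 2 ≤ n) (a : EuclideanSpace ℝ (Fin n)) (ε : ℝ)
    (y : EuclideanSpace ℝ (Fin n)) : ℝ :=
  {y | ε < ‖y - a‖}.indicator (fun y => secondRieszKernel n hn (y - a)) y

/-- The normalized indicator function of the closed ball `B(a, ε)`. -/
noncomputable def ballDensity (a : EuclideanSpace ℝ (Fin n)) (ε : ℝ)
    (y : EuclideanSpace ℝ (Fin n)) : ℝ :=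
  (Metric.closedBall a ε).indicator (fun _ => (volume.real (Metric.closedBall a ε))⁻¹) y

theorem memLp_truncatedKernel (hn : 2 ≤ n) (a : EuclideanSpace ℝ (Fin n)) {ε : ℝ} (hε : 0 < ε) :
    MemLp (fun y => (truncatedKernel hn a ε y : ℂ)) 2 volume := by
  have h := (memLp_radialFieldDeriv (by omega) a hε
    (⟨0, by omega⟩ : Fin n) ⟨1, by omega⟩).const_mul (-(n : ℂ)⁻¹)
  refine h.congr_norm (by
    refine Measurable.aestronglyMeasurable ?_
    have : Measurable (truncatedKernel hn a ε) := by
      refine Measurable.indicator (by unfold secondRieszKernel; fun_prop) ?_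
      exact measurableSet_lt measurable_const (by fun_prop)
    fun_prop) (Eventually.of_forall fun y => ?_)
  rw [radialFieldDeriv_zero_one hn, truncatedKernel]
  have : (n : ℂ) ≠ 0 := by simp; omega
  congr 1
  push_cast
  field_simp

theorem memLp_ballDensity (a : EuclideanSpace ℝ (Fin n)) (ε : ℝ) :
    MemLp (fun y => (ballDensity a ε y : ℂ)) 2 volume :=
  (memLp_indicator_const 2 (measurableSet_closedBall (x := a) (ε := ε)) _
    (Or.inr measure_closedBall_lt_top.ne)).ofReal

/-- Only the second derivatives `u i j` of `φ` are Fourier transformed: they lie in `L²`, whereas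
`∇φ` does not when `n = 2`. The relations between them replace division by a transform of `φ`. -/
theorem rieszOperator_ballDensity (hn : 2 ≤ n) (a : EuclideanSpace ℝ (Fin n)) {ε : ℝ}
    (hε : 0 < ε) :
    rieszOperator hn ((memLp_ballDensity a ε).toLp _) = (memLp_truncatedKernel hn a hε).toLp _ := by
  have hn1 : 1 ≤ n := by omega
  have : Nonempty (Fin n) := ⟨⟨0, hn1⟩⟩
  set ω := volume.real (Metric.closedBall (0 : EuclideanSpace ℝ (Fin n)) 1) with hω
  have hω0 : ω ≠ 0 :=
    (ENNReal.toReal_pos (Metric.measure_closedBall_pos _ _ one_pos).ne'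
      measure_closedBall_lt_top.ne).ne'
  have hn0 : (n : ℂ) ≠ 0 := by simp; omega
  set i₀ : Fin n := ⟨0, by omega⟩ with hi₀
  set i₁ : Fin n := ⟨1, by omega⟩ with hi₁
  set u : Fin n → Fin n → Lp (α := EuclideanSpace ℝ (Fin n)) ℂ 2 volume :=
    fun i j => (memLp_radialFieldDeriv hn1 a hε i j).toLp _ with hu
  set k := (memLp_truncatedKernel hn a hε).toLp _ with hk
  set b := (memLp_ballDensity a ε).toLp _ with hb
  have hucoe : ∀ i j, u i j =ᵐ[volume] fun y => (radialFieldDeriv a ε i j y : ℂ) := fun i j =>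
    MemLp.coeFn_toLp _
  have hsymm : ∀ i j, u i j = u j i := fun i j => by
    simp only [hu, radialFieldDeriv_comm a ε i j]
  have hrel : ∀ i j l, ∀ᵐ ξ, (ξ l : ℂ) * (𝓕 (u i j) : Lp (α := EuclideanSpace ℝ (Fin n)) ℂ 2 volume) ξ =
      (ξ j : ℂ) * (𝓕 (u i l) : Lp (α := EuclideanSpace ℝ (Fin n)) ℂ 2 volume) ξ := fun i j l => by
    have h := ae_inner_mul_fourier_eq (u := u i j) (u' := u i l)
      (v := EuclideanSpace.single j 1) (w := EuclideanSpace.single l 1) (fun g => by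
        have h1 := integral_radialFieldDeriv_mul_fderiv hn1 a hε i j l g
        have h2 : ∀ j (v : EuclideanSpace ℝ (Fin n)), ∫ y, u i j y * fderiv ℝ g y v =
            ∫ y, (radialFieldDeriv a ε i j y : ℂ) * fderiv ℝ g y v := fun j v =>
          integral_congr_ae ((hucoe i j).mono fun y hy => by simp only [hy])
        rw [h2, h2, h1])
    simpa [EuclideanSpace.inner_single_right] using h
  have hk01 : u i₀ i₁ = (-(n : ℂ)) • k := by
    rw [hk, ← MemLp.toLp_const_smul]
    refine MemLp.toLp_congr _ _ (Eventually.of_forall fun y => ?_)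
    simp only [hi₀, hi₁, radialFieldDeriv_zero_one hn, Pi.smul_apply, smul_eq_mul, truncatedKernel]
    push_cast
    ring
  have htr : ∑ i, u i i = ((n : ℂ) * ω) • b := by
    refine Lp.ext ?_
    have h1 : ∀ᵐ y, ∀ i, u i i y = (radialFieldDeriv a ε i i y : ℂ) := by
      rw [ae_all_iff]; exact fun i => hucoe i i
    filter_upwards [h1, Lp.coeFn_fun_finsetSum Finset.univ (fun i => u i i),
      Lp.coeFn_smul ((n : ℂ) * ω) b, (memLp_ballDensity a ε).coeFn_toLp] with y h1 h2 h3 h4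
    rw [h2, h3, Pi.smul_apply, hb, h4]
    simp only [h1]
    rw [← Complex.ofReal_sum, sum_radialFieldDeriv a hε, ballDensity,
      Measure.addHaar_real_closedBall' _ a hε.le, ← hω, finrank_euclideanSpace_fin]
    by_cases hy : y ∈ Metric.closedBall a ε
    · simp only [Set.indicator_of_mem hy, smul_eq_mul]
      push_cast
      have : (ω : ℂ) ≠ 0 := by exact_mod_cast hω0
      field_simp
    · simp [Set.indicator_of_notMem hy]
  have hk01' := congrArg (Lp.fourierTransformₗᵢ (EuclideanSpace ℝ (Fin n)) ℂ) hk01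
  have htr' := congrArg (Lp.fourierTransformₗᵢ (EuclideanSpace ℝ (Fin n)) ℂ) htr
  rw [map_smul] at hk01' htr'
  rw [map_sum] at htr'
  change 𝓕 (u i₀ i₁) = (-(n : ℂ)) • 𝓕 k at hk01'
  change ∑ i, 𝓕 (u i i) = ((n : ℂ) * ω) • 𝓕 b at htr'
  have hkey : 𝓕 (rieszOperator hn b) = 𝓕 k := by
    refine Lp.ext ?_
    have hA : ∀ᵐ ξ, ∀ i, (ξ i : ℂ) * (𝓕 (u i₀ i₁) : Lp (α := EuclideanSpace ℝ (Fin n)) ℂ 2 volume) ξ =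
        (ξ i₁ : ℂ) * (𝓕 (u i i₀) : Lp (α := EuclideanSpace ℝ (Fin n)) ℂ 2 volume) ξ := by
      rw [ae_all_iff]; exact fun i => hsymm i i₀ ▸ hrel i₀ i₁ i
    have hB : ∀ᵐ ξ, ∀ i, (ξ i : ℂ) * (𝓕 (u i i₀) : Lp (α := EuclideanSpace ℝ (Fin n)) ℂ 2 volume) ξ =
        (ξ i₀ : ℂ) * (𝓕 (u i i) : Lp (α := EuclideanSpace ℝ (Fin n)) ℂ 2 volume) ξ := by
      rw [ae_all_iff]; exact fun i => hrel i i₀ i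
    have hne : ∀ᵐ ξ : EuclideanSpace ℝ (Fin n), ξ ≠ 0 := by simp [ae_iff]
    have hC := Lp.coeFn_fun_finsetSum Finset.univ
      (fun i => (𝓕 (u i i) : Lp (α := EuclideanSpace ℝ (Fin n)) ℂ 2 volume))
    rw [htr'] at hC
    have hD := Lp.coeFn_smul (-(n : ℂ)) (𝓕 k : Lp (α := EuclideanSpace ℝ (Fin n)) ℂ 2 volume)
    rw [← hk01'] at hD
    filter_upwards [fourier_rieszOperator_ae hn b, hA, hB, hne, hC, hD,
      Lp.coeFn_smul ((n : ℂ) * ω) (𝓕 b : Lp (α := EuclideanSpace ℝ (Fin n)) ℂ 2 volume)]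
      with ξ h1 hA hB hne hC hD hF
    rw [h1, rieszSymbol, ← hω]
    rw [hF, Pi.smul_apply, smul_eq_mul] at hC
    rw [Pi.smul_apply, smul_eq_mul] at hD
    -- For each `i`, `ξᵢ² û₀₁ = ξᵢ ξ₁ û_{i0} = ξ₀ ξ₁ û_{ii}` (indices from zero). Summing over `i`
    -- produces the transform of the trace.
    have hsum : ((‖ξ‖ ^ 2 : ℝ) : ℂ) * (𝓕 (u i₀ i₁) : Lp (α := EuclideanSpace ℝ (Fin n)) ℂ 2 volume) ξ =
        ξ i₀ * ξ i₁ * ((n : ℂ) * ω * (𝓕 b : Lp (α := EuclideanSpace ℝ (Fin n)) ℂ 2 volume) ξ) := by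
      rw [hC, EuclideanSpace.real_norm_sq_eq, Complex.ofReal_sum, Finset.sum_mul, Finset.mul_sum]
      refine Finset.sum_congr rfl fun i _ => ?_
      rw [Complex.ofReal_pow, sq, mul_assoc, hA i, mul_left_comm, hB i]
      ring
    rw [hD] at hsum
    have hξ : (‖ξ‖ : ℂ) ≠ 0 := by exact_mod_cast (norm_pos_iff.2 hne).ne'
    push_cast at hsum ⊢
    field_simp
    refine mul_left_cancel₀ hn0 ?_
    linear_combination hsum
  have := congrArg (fun f : Lp (α := EuclideanSpace ℝ (Fin n)) ℂ 2 =>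
    (𝓕⁻ f : Lp (α := EuclideanSpace ℝ (Fin n)) ℂ 2 volume)) hkey
  simpa only [FourierTransform.fourierInv_fourier_eq] using this

theorem secondRieszKernel_neg (hn : 2 ≤ n) (y : EuclideanSpace ℝ (Fin n)) :
    secondRieszKernel n hn (-y) = secondRieszKernel n hn y := by
  simp [secondRieszKernel]

theorem mul_truncatedKernel_sub (hn : 2 ≤ n) (f : EuclideanSpace ℝ (Fin n) → ℂ) (ε : ℝ)
    (x y : EuclideanSpace ℝ (Fin n)) :
    f (x - y) * (truncatedKernel hn x ε (x - y) : ℂ) =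
      {y | ε < ‖y‖}.indicator (fun y => f (x - y) * (secondRieszKernel n hn y : ℂ)) y := by
  by_cases h : ε < ‖y‖
  · rw [Set.indicator_of_mem (by exact h), truncatedKernel, Set.indicator_of_mem (by simpa using h)]
    simp [secondRieszKernel_neg]
  · rw [Set.indicator_of_notMem (by exact h), truncatedKernel,
      Set.indicator_of_notMem (by simpa using h)]
    simp

theorem measurableSet_lt_norm (ε : ℝ) :
    MeasurableSet {y : EuclideanSpace ℝ (Fin n) | ε < ‖y‖} :=
  measurableSet_lt measurable_const measurable_norm

theorem integrableOn_mul_secondRieszKernel (hn : 2 ≤ n) {f : EuclideanSpace ℝ (Fin n) → ℂ}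
    (hf : MemLp f 2 volume) {ε : ℝ} (hε : 0 < ε) (x : EuclideanSpace ℝ (Fin n)) :
    IntegrableOn (fun y => f (x - y) * (secondRieszKernel n hn y : ℂ)) {y | ε < ‖y‖} volume := by
  rw [← integrable_indicator_iff (measurableSet_lt_norm ε)]
  refine ((hf.integrable_mul (memLp_truncatedKernel hn x hε)).comp_sub_left x).congr
    (Eventually.of_forall fun y => ?_)
  exact mul_truncatedKernel_sub hn f ε x y

/-- Truncations of the singular integral are means over balls. -/
theorem truncatedSI_eq_average (hn : 2 ≤ n) {f : EuclideanSpace ℝ (Fin n) → ℂ}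
    (hf : MemLp f 2 volume) {ε : ℝ} (hε : 0 < ε) (x : EuclideanSpace ℝ (Fin n)) :
    truncatedSI (secondRieszKernel n hn) ε f x =
      ⨍ y in Metric.closedBall x ε, rieszOperator hn (hf.toLp f) y := by
  -- The substitution `y ↦ x - y` uses that the kernel is even.
  have h1 : truncatedSI (secondRieszKernel n hn) ε f x =
      ∫ y, f y * (truncatedKernel hn x ε y : ℂ) := by
    rw [truncatedSI, ← integral_indicator (measurableSet_lt_norm ε),
      ← integral_sub_left_eq_self (fun y => f y * (truncatedKernel hn x ε y : ℂ)) volume x]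
    simp only [mul_truncatedKernel_sub hn f ε x]
  have h2 : inner ℂ ((memLp_truncatedKernel hn x hε).toLp _) (hf.toLp f) =
      ∫ y, f y * (truncatedKernel hn x ε y : ℂ) := by
    rw [L2.inner_def]
    refine integral_congr_ae ?_
    filter_upwards [hf.coeFn_toLp, (memLp_truncatedKernel hn x hε).coeFn_toLp] with y h3 h4
    rw [h3, h4]
    simp
  have h3 : inner ℂ ((memLp_ballDensity x ε).toLp _) (rieszOperator hn (hf.toLp f)) =
      ⨍ y in Metric.closedBall x ε, rieszOperator hn (hf.toLp f) y := by
    rw [L2.inner_def, setAverage_eq, ← integral_smul, ← integral_indicator measurableSet_closedBall]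
    refine integral_congr_ae ?_
    filter_upwards [(memLp_ballDensity x ε).coeFn_toLp] with y h4
    rw [h4, ballDensity]
    by_cases hy : y ∈ Metric.closedBall x ε
    · simp [Set.indicator_of_mem hy, mul_comm]
    · simp [Set.indicator_of_notMem hy]
  rw [h1, ← h2, ← rieszOperator_ballDensity hn x hε, inner_rieszOperator_comm, h3]

/-- Since truncations are ball averages of a locally integrable function, this is Lebesgue
differentiation; no prior maximal inequality for the truncations is needed. -/
theorem ae_tendsto_truncatedSI (hn : 2 ≤ n) {f : EuclideanSpace ℝ (Fin n) → ℂ}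
    (hf : MemLp f 2 volume) :
    ∀ᵐ x, Tendsto (fun ε : ℝ => truncatedSI (secondRieszKernel n hn) ε f x) (𝓝[>] 0)
      (𝓝 (rieszOperator hn (hf.toLp f) x)) := by
  have hloc : LocallyIntegrable (rieszOperator hn (hf.toLp f)) :=
    (Lp.memLp _).locallyIntegrable (by norm_num)
  filter_upwards [IsUnifLocDoublingMeasure.ae_tendsto_average volume hloc 1] with x hx
  refine (hx (fun _ => x) id tendsto_id ?_).congr' ?_
  · filter_upwards [self_mem_nhdsWithin] with ε hε
    exact Metric.mem_closedBall_self (by simpa using le_of_lt hε)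
  · filter_upwards [self_mem_nhdsWithin] with ε hε
    exact (truncatedSI_eq_average hn hf hε x).symm

theorem principalValueSI_ae_eq (hn : 2 ≤ n) {f : EuclideanSpace ℝ (Fin n) → ℂ}
    (hf : MemLp f 2 volume) :
    principalValueSI (secondRieszKernel n hn) f =ᵐ[volume] rieszOperator hn (hf.toLp f) :=
  (ae_tendsto_truncatedSI hn hf).mono fun _ hx => hx.limUnder_eq

theorem truncatedSI_eq_average_principalValueSI (hn : 2 ≤ n)
    {f : EuclideanSpace ℝ (Fin n) → ℂ} (hf : MemLp f 2 volume) {ε : ℝ} (hε : 0 < ε)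
    (x : EuclideanSpace ℝ (Fin n)) :
    truncatedSI (secondRieszKernel n hn) ε f x =
      ⨍ y in Metric.closedBall x ε, principalValueSI (secondRieszKernel n hn) f y := by
  rw [truncatedSI_eq_average hn hf hε x]
  exact average_congr (ae_restrict_of_ae (principalValueSI_ae_eq hn hf).symm)

theorem maximalSI_le_hardyLittlewoodMax (hn : 2 ≤ n) {f : EuclideanSpace ℝ (Fin n) → ℂ}
    (hf : MemLp f 2 volume) (x : EuclideanSpace ℝ (Fin n)) :
    maximalSI (secondRieszKernel n hn) f x ≤
      hardyLittlewoodMax (principalValueSI (secondRieszKernel n hn) f) x := by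
  refine iSup₂_mono fun ε hε => ?_
  rw [truncatedSI_eq_average_principalValueSI hn hf hε x, average]
  refine (enorm_integral_le_lintegral_enorm _).trans ?_
  rw [lintegral_smul_measure, Measure.restrict_apply_univ, smul_eq_mul]

end RieszOperator

theorem theorem1 (n : ℕ) (hn : 2 ≤ n) :
    -- `T f` is well defined for `f ∈ L²`, and every truncation is a mean of `T f` over a ball
    (∀ f : EuclideanSpace ℝ (Fin n) → ℂ, MemLp f 2 volume →
      (∀ ε : ℝ, 0 < ε → ∀ x : EuclideanSpace ℝ (Fin n),
        IntegrableOn (fun y => f (x - y) * (secondRieszKernel n hn y : ℂ)) {y | ε < ‖y‖} volume) ∧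
      (∀ᵐ x ∂(volume : Measure (EuclideanSpace ℝ (Fin n))),
        Tendsto (fun ε : ℝ => truncatedSI (secondRieszKernel n hn) ε f x) (𝓝[>] 0)
          (𝓝 (principalValueSI (secondRieszKernel n hn) f x))) ∧
      MemLp (principalValueSI (secondRieszKernel n hn) f) 2 volume ∧
      (∀ ε : ℝ, 0 < ε → ∀ x : EuclideanSpace ℝ (Fin n),
        truncatedSI (secondRieszKernel n hn) ε f x =
          ⨍ y in Metric.closedBall x ε, principalValueSI (secondRieszKernel n hn) f y)) ∧
    -- the pointwise estimate `T* f ≤ C M(T f)`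
    (∃ C : ℝ≥0, ∀ f : EuclideanSpace ℝ (Fin n) → ℂ, MemLp f 2 volume →
      ∀ x : EuclideanSpace ℝ (Fin n),
        maximalSI (secondRieszKernel n hn) f x ≤
          (C : ℝ≥0∞) * hardyLittlewoodMax (principalValueSI (secondRieszKernel n hn) f) x) ∧
    -- the truncated kernel is `T b` for a bounded `b` supported on the closed unit ball
    (∃ b : EuclideanSpace ℝ (Fin n) → ℝ, Measurable b ∧ (∃ D : ℝ, ∀ x, |b x| ≤ D) ∧
      (∀ x, x ∉ Metric.closedBall (0 : EuclideanSpace ℝ (Fin n)) 1 → b x = 0) ∧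
      ∀ᵐ x ∂(volume : Measure (EuclideanSpace ℝ (Fin n))),
        principalValueSI (secondRieszKernel n hn) (fun y => (b y : ℂ)) x =
          ((Set.indicator (Metric.closedBall (0 : EuclideanSpace ℝ (Fin n)) 1)ᶜ
            (secondRieszKernel n hn) x : ℝ) : ℂ)) := by
  -- The witness `C = 1` works because each truncation is itself a mean over a centred ball.
  refine ⟨fun f hf => ⟨fun ε hε x => integrableOn_mul_secondRieszKernel hn hf hε x, ?_, ?_,
    fun ε hε x => truncatedSI_eq_average_principalValueSI hn hf hε x⟩, ⟨1, fun f hf x => ?_⟩,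
    ballDensity 0 1, ?_, ⟨(volume.real (Metric.closedBall (0 : EuclideanSpace ℝ (Fin n)) 1))⁻¹,
      fun x => ?_⟩, fun x hx => Set.indicator_of_notMem hx _, ?_⟩
  · filter_upwards [ae_tendsto_truncatedSI hn hf, principalValueSI_ae_eq hn hf] with x h1 h2
    rwa [h2]
  · exact (memLp_congr_ae (principalValueSI_ae_eq hn hf)).2 (Lp.memLp _)
  · rw [ENNReal.coe_one, one_mul]
    exact maximalSI_le_hardyLittlewoodMax hn hf x
  · exact measurable_const.indicator measurableSet_closedBall
  · rw [ballDensity, ← Real.norm_eq_abs]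
    refine (norm_indicator_le_norm_self _ _).trans ?_
    rw [Real.norm_of_nonneg (inv_nonneg.2 measureReal_nonneg)]
  · have h := principalValueSI_ae_eq hn (memLp_ballDensity (0 : EuclideanSpace ℝ (Fin n)) 1)
    rw [rieszOperator_ballDensity hn 0 one_pos] at h
    refine (h.trans (memLp_truncatedKernel hn 0 one_pos).coeFn_toLp).mono fun x hx => ?_
    rw [hx]
    simp only [truncatedKernel]
    have hset : {y : EuclideanSpace ℝ (Fin n) | 1 < ‖y - 0‖} =
        (Metric.closedBall (0 : EuclideanSpace ℝ (Fin n)) 1)ᶜ := by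
      ext y; simp
    rw [hset]
    simp only [sub_zero]
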